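/- Let $d\ge 1$ and $N\ge 2$. An $N$-step self-avoiding walk on $\mathbb Z^d$ is a sequence $(\omega_0,\dots,\omega_N)$ of pairwise distinct points of $\mathbb Z^d$ with $\omega_0=0$ and $\|\omega_{i+1}-\omega_i\|_2=1$ for $0\le i<N$. Let $\Omega_N$ be the (finite) set of these walks and $\pi$ the uniform probability distribution on $\Omega_N$. Let $E_d=\{\pm e_1,\dots,\pm e_d\}$, where $e_1,\dots,e_d$ is the canonical basis of $\mathbb R^d$. For $\gamma_1\in E_d$ let $K_{(0,\gamma_1)}=\{\omega\in\Omega_N:\ \omega_0=0,\ \omega_1=\gamma_1\}$ and let $\rho_{\gamma_1}$ be the uniform probability distribution on $K_{(0,\gamma_1)}$. Let $B_N\subseteq\Omega_N$ be the set of straight walks, i.e. the walks $\omega$ with $\omega_i=i\gamma$ for all $0\le i\le N$, for some $\gamma\in E_d$. Let $\mathcal O_d$ be the (finite) set of orthogonal linear transformations of $\mathbb R^d$ that leave the lattice $\mathbb Z^d$ invariant. Distributions are row vectors indexed by the finite set concerned, and $e'$ is the column vector of the appropriate size with all entries $1$, so that $e'\rho$ is the matrix all of whose rows are $\rho$. Convergence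 of vectors and matrices is entrywise. The pivot$^+$ chain on $\Omega_N$ is the following Markov chain. At time $0$ it is at a given walk $\omega\in\Omega_N$. In its first step it moves to a walk chosen uniformly from $B_N$. In each later step, being at a walk $\tau$, it chooses a pivot $k$ uniformly from $\{1,\dots,N-1\}$ and, independently, $T$ uniformly from $\mathcal O_d$, and forms the walk $\tau'$ with $\tau'_i=\tau_i$ for $i\le k$ and $\tau'_i=\tau_k+T(\tau_i-\tau_k)$ for $i>k$; it moves to $\tau'$ if $\tau'$ is self-avoiding and stays at $\tau$ otherwise. Let $p_n$ be the distribution of the chain at time $n$. Theorem 2.8. (i) $(p_0)_\alpha=1$ if $\alpha=\omega$ and $(p_0)_\alpha=0$ if $\alpha\in\Omega_N$, $\alpha\ne\omega$. (ii) Let $P_1$ be the transition matrix of the first step and $P_2$ that of each later step, so that the chain has transition matrices $P_1,P_2,P_2,\dots$: $p_1=p_0P_1$ and $p_{n+1}=p_nP_2$ for all $n\ge1$. For all $\alpha,\beta\in\Omega_N$, $(P_1)_{\alpha\beta}=\frac1{2d}$ if $\beta\in B_N$ and $(P_1)_{\alpha\beta}=0$ if $\beta\notin B_N$. The classes $K_{(0,\gamma_1)}$,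 $\gamma_1\in E_d$, partition $\Omega_N$, and, when the walks are listed class by class, $P_2$ is block diagonal with diagonal blocks $Q_{\gamma_1}=\big((P_2)_{\alpha\beta}\big)_{\alpha,\beta\in K_{(0,\gamma_1)}}$, $\gamma_1\in E_d$, each of which is a stochastic matrix. (iii) $\rho_{\gamma_1}Q_{\gamma_1}=\rho_{\gamma_1}$ for all $\gamma_1\in E_d$. (iv) $Q_{\gamma_1}^n\to e'\rho_{\gamma_1}$ as $n\to\infty$, for all $\gamma_1\in E_d$. (v) $P_1P_2^n\to e'\pi$ as $n\to\infty$. (vi) $p_n\to\pi$ as $n\to\infty$. -/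

import Mathlib

open Filter Topology

namespace PivotPlus

/-- The Euclidean space `ℝ^d`, with the 2-norm. -/
abbrev Space (d : ℕ) : Type := EuclideanSpace ℝ (Fin d)

/-- The set of points of `ℤ^d`, inside `ℝ^d`. -/
def lattice (d : ℕ) : Set (Space d) := {x | ∀ j, ∃ m : ℤ, x j = (m : ℝ)}

/-- `w = (w₀, …, w_N)` is an `N`-step self-avoiding walk on `ℤ^d`. -/
structure IsSAW {d N : ℕ} (w : Fin (N + 1) → Space d) : Prop where
  mem_lattice : ∀ i, w i ∈ lattice d
  zero : w 0 = 0
  step : ∀ i : Fin N, ‖w i.succ - w i.castSucc‖ = 1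
  injective : ∀ i j, i ≠ j → w i ≠ w j

/-- The set `Ω_N` of `N`-step self-avoiding walks on `ℤ^d`. -/
def SAW (d N : ℕ) : Type := {w : Fin (N + 1) → Space d // IsSAW w}

instance (d N : ℕ) : CoeFun (SAW d N) (fun _ => Fin (N + 1) → Space d) := ⟨fun ω => ω.1⟩

/-- The set `𝒪_d` of orthogonal linear transformations of `ℝ^d` leaving the lattice invariant. -/
def LatticeSymm (d : ℕ) : Type :=
  {T : Space d ≃ₗᵢ[ℝ] Space d // T '' lattice d = lattice d}

/-- The set `E_d = {e₁, …, e_d, -e₁, …, -e_d}`. -/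
def unitSteps (d : ℕ) : Set (Space d) :=
  {v | ∃ j : Fin d, v = EuclideanSpace.single j 1 ∨ v = -EuclideanSpace.single j 1}

/-! Finiteness of `Ω_N` and `𝒪_d`. -/

theorem finite_lattice_ball (d R : ℕ) : {x : Space d | x ∈ lattice d ∧ ‖x‖ ≤ R}.Finite := by
  have hfin : (Set.pi Set.univ (fun _ : Fin d => Set.Icc (-(R : ℤ)) R)).Finite :=
    Set.Finite.pi' (fun _ => Set.finite_Icc _ _) |>.subset (fun m hm i => hm i trivial)
  refine (hfin.image (fun m : Fin d → ℤ => (WithLp.toLp 2 (fun j => (m j : ℝ)) : Space d))).subset ?_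
  rintro x ⟨hx, hR⟩
  choose m hm using hx
  refine ⟨m, fun j _ => ?_, ?_⟩
  · have h1 : |x j| ≤ R := (PiLp.norm_apply_le x j).trans hR
    have h2 : |((m j : ℤ) : ℝ)| ≤ (R : ℝ) := by rw [← hm j]; exact h1
    exact abs_le.1 (by exact_mod_cast h2)
  · ext j
    simp [hm j]

theorem IsSAW.norm_le {d N : ℕ} {w : Fin (N + 1) → Space d} (hw : IsSAW w) (i : Fin (N + 1)) :
    ‖w i‖ ≤ (N : ℝ) := by
  have key : ‖w i‖ ≤ ((i : ℕ) : ℝ) := by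
    induction i using Fin.induction with
    | zero => simp [hw.zero]
    | succ i ih =>
      have h := norm_add_le (w i.succ - w i.castSucc) (w i.castSucc)
      rw [sub_add_cancel, hw.step i] at h
      simp only [Fin.val_castSucc, Fin.val_succ] at ih ⊢
      push_cast
      linarith
  exact key.trans (by exact_mod_cast Nat.lt_succ_iff.mp i.2)

instance (d N : ℕ) : Finite (SAW d N) := by
  have hfin : {w : Fin (N + 1) → Space d | ∀ i, w i ∈ {x | x ∈ lattice d ∧ ‖x‖ ≤ N}}.Finite :=
    Set.Finite.pi' (fun _ => finite_lattice_ball d N)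
  exact (hfin.subset (fun w (hw : IsSAW w) i => ⟨hw.mem_lattice i, hw.norm_le i⟩)).to_subtype

theorem single_mem_lattice {d : ℕ} (j : Fin d) : EuclideanSpace.single j (1 : ℝ) ∈ lattice d := by
  intro i
  by_cases h : i = j
  · exact ⟨1, by simp [h]⟩
  · exact ⟨0, by simp [h]⟩

instance (d : ℕ) : Finite (LatticeSymm d) := by
  have hfin : {w : Fin d → Space d | ∀ i, w i ∈ {x | x ∈ lattice d ∧ ‖x‖ ≤ (1 : ℕ)}}.Finite :=
    Set.Finite.pi' (fun _ => finite_lattice_ball d 1)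
  have := hfin.to_subtype
  refine Finite.of_injective (β := {w : Fin d → Space d |
    ∀ i, w i ∈ {x | x ∈ lattice d ∧ ‖x‖ ≤ (1 : ℕ)}})
    (fun T => ⟨fun j => T.1 (EuclideanSpace.single j 1), fun j => ⟨?_, ?_⟩⟩) ?_
  · have h : T.1 (EuclideanSpace.single j 1) ∈ T.1 '' lattice d :=
      ⟨_, single_mem_lattice j, rfl⟩
    rwa [T.2] at h
  · simp
  · intro S T h
    have h' := congrArg Subtype.val h
    apply Subtype.ext
    apply LinearIsometryEquiv.toLinearEquiv_injective
    apply LinearEquiv.toLinearMap_injective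
    refine (EuclideanSpace.basisFun (Fin d) ℝ).toBasis.ext (fun j => ?_)
    simpa using congrFun h' j

noncomputable instance (d N : ℕ) : Fintype (SAW d N) := Fintype.ofFinite _
noncomputable instance (d N : ℕ) : DecidableEq (SAW d N) := Classical.decEq _
noncomputable instance (d : ℕ) : Fintype (LatticeSymm d) := Fintype.ofFinite _
noncomputable instance (d : ℕ) : DecidableEq (unitSteps d) := Classical.decEq _

instance (d : ℕ) : Nonempty (LatticeSymm d) :=
  ⟨⟨LinearIsometryEquiv.refl ℝ _, by simp⟩⟩

/-- The class `K_{(0,γ)}` of walks `ω ∈ Ω_N` with `ω₀ = 0` and `ω₁ = γ`. -/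
def firstStepClass (N : ℕ) {d : ℕ} (γ : unitSteps d) : Set (SAW d N) :=
  {ω | ω 0 = 0 ∧ ω 1 = γ.1}

noncomputable instance (N : ℕ) {d : ℕ} (γ : unitSteps d) : Fintype (firstStepClass N γ) :=
  Fintype.ofFinite _

/-- The set `B_N` of `N`-step straight self-avoiding walks. -/
def straightWalks (d N : ℕ) : Set (SAW d N) :=
  {ω | ∃ γ ∈ unitSteps d, ∀ i : Fin (N + 1), ω i = (i : ℕ) • γ}

theorem straightWalks_nonempty {d : ℕ} (N : ℕ) (hd : 1 ≤ d) : (straightWalks d N).Nonempty := by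
  set e : Space d := EuclideanSpace.single ⟨0, hd⟩ 1 with he
  have hnorm : ‖e‖ = 1 := by simp [he]
  have hne : e ≠ 0 := by rw [← norm_ne_zero_iff, hnorm]; exact one_ne_zero
  refine ⟨⟨fun i => (i : ℕ) • e, ⟨fun i j => ?_, by simp, fun i => ?_, fun i j hij h => ?_⟩⟩,
    e, ⟨_, Or.inl rfl⟩, fun i => rfl⟩
  · obtain ⟨m, hm⟩ := single_mem_lattice (⟨0, hd⟩ : Fin d) j
    exact ⟨(i : ℕ) * m, by rw [← he] at hm; simp [hm]⟩
  · simp [succ_nsmul, hnorm]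
  · have h' : ((i : ℕ) : ℝ) • e = ((j : ℕ) : ℝ) • e := by
      simpa only [Nat.cast_smul_eq_nsmul] using h
    exact hij (Fin.ext (by exact_mod_cast smul_left_injective ℝ hne h'))

/-- The walk obtained from `w` by fixing its first `k` steps and performing `T` on the remaining
part, with `w_k` as the origin for the transformation. -/
noncomputable def rotate {d N : ℕ} (k : Fin (N + 1)) (T : LatticeSymm d) (w : Fin (N + 1) → Space d) :
    Fin (N + 1) → Space d :=
  fun i => if i ≤ k then w i else w k + T.1 (w i - w k)

open Classical in
/-- Accept the rotated walk if it is self-avoiding, otherwise keep the current walk. -/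
noncomputable def pivotUpdate {d N : ℕ} (k : Fin (N + 1)) (T : LatticeSymm d) (α : SAW d N) :
    SAW d N :=
  if h : IsSAW (rotate k T α) then ⟨rotate k T α, h⟩ else α

/-- The set `{1, …, N-1}` of pivots. -/
def pivots (N : ℕ) : Finset (Fin (N + 1)) := Finset.Ioo 0 (Fin.last N)

theorem pivots_nonempty {N : ℕ} (hN : 2 ≤ N) : (pivots N).Nonempty :=
  ⟨⟨1, by omega⟩, by
    simp only [pivots, Finset.mem_Ioo, Fin.lt_def, Fin.val_last, Fin.val_zero]
    omega⟩

/-- The first iteration of the algorithm: whatever the current walk is, the new one is uniform on `B_N`. -/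
noncomputable def straightStep {d : ℕ} (N : ℕ) (hd : 1 ≤ d) (_α : SAW d N) : PMF (SAW d N) :=
  PMF.uniformOfFinset (Set.toFinite (straightWalks d N)).toFinset
    ((Set.Finite.toFinset_nonempty _).2 (straightWalks_nonempty N hd))

/-- One later iteration of the algorithm: choose a pivot `k` uniformly in `{1, …, N-1}`, then `T`
uniformly in `𝒪_d`, and accept or reject the rotated walk. -/
noncomputable def pivotStep (d : ℕ) {N : ℕ} (hN : 2 ≤ N) (α : SAW d N) : PMF (SAW d N) :=
  (PMF.uniformOfFinset (pivots N) (pivots_nonempty hN)).bind fun k =>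
    (PMF.uniformOfFintype (LatticeSymm d)).bind fun T => PMF.pure (pivotUpdate k T α)

/-- The law at time `n` of the pivot⁺ chain started from `ω`. -/
noncomputable def law {d N : ℕ} (hd : 1 ≤ d) (hN : 2 ≤ N) (ω : SAW d N) : ℕ → PMF (SAW d N)
  | 0 => PMF.pure ω
  | 1 => (PMF.pure ω).bind (straightStep N hd)
  | n + 2 => (law hd hN ω (n + 1)).bind (pivotStep d hN)

/-- `p_n` as a (row) vector indexed by `Ω_N`. -/
noncomputable def distribution {d N : ℕ} (hd : 1 ≤ d) (hN : 2 ≤ N) (ω : SAW d N) (n : ℕ) : SAW d N → ℝ :=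
  fun α => (law hd hN ω n α).toReal

/-- The transition matrix of the first iteration. -/
noncomputable def P₁ {d : ℕ} (N : ℕ) (hd : 1 ≤ d) : Matrix (SAW d N) (SAW d N) ℝ :=
  Matrix.of fun α β => (straightStep N hd α β).toReal

/-- The transition matrix of every later iteration. -/
noncomputable def P₂ (d : ℕ) {N : ℕ} (hN : 2 ≤ N) : Matrix (SAW d N) (SAW d N) ℝ :=
  Matrix.of fun α β => (pivotStep d hN α β).toReal

/-- The matrix `Q_γ` of transition probabilities within the class `K_{(0,γ)}`. -/
noncomputable def Q {d N : ℕ} (hN : 2 ≤ N) (γ : unitSteps d) :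
    Matrix (firstStepClass N γ) (firstStepClass N γ) ℝ :=
  (P₂ d hN).submatrix Subtype.val Subtype.val

/-- The map `(γ, α) ↦ α` listing `Ω_N` class by class. -/
def ofClass (d N : ℕ) (x : (γ : unitSteps d) × firstStepClass N γ) : SAW d N := x.2.1

/-- The uniform probability distribution on a nonempty finite set, as a vector. -/
noncomputable def uniform (ι : Type) [Fintype ι] : ι → ℝ := fun _ => 1 / (Fintype.card ι : ℝ)

/-- The stable matrix `e'ρ`, all of whose rows are `ρ`. -/
def stable {ι : Type} (ρ : ι → ℝ) : Matrix ι ι ℝ := Matrix.vecMulVec 1 ρ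

end PivotPlus

open PivotPlus

/-!
Pivoting by the inverse lattice symmetry undoes a pivot, so `P₂` is symmetric, and pivots at
`k ≥ 1` keep the first step. Hence `P₂` is block diagonal with one symmetric stochastic block `Q γ`
for each class of walks with first step `γ`, and the uniform distribution on the class is
stationary for `Q γ`.

The main point is the irreducibility of each block (Madras and Sokal). To a walk assign its
`potential`: the sum of the side lengths of its bounding box plus the number of its straight angles.
A walk that is not straight admits a pivot to a walk of larger potential. If some face of the box
contains neither endpoint, reflect the part of the walk after a point of that face in the face
(`exists_pivot_of_interior_max`). Otherwise the endpoints are opposite corners of the box, and the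
last bend of the walk can be straightened by turning the final straight segment out of the box
(`exists_pivot_of_opposite_corners`). So a walk of maximal potential among those reachable from a
given one is straight. A class contains just one straight walk, and moves are reversible, so
the block is irreducible (`reflTransGen_straightWalk`).

The identity symmetry gives positive diagonal entries, so each block is primitive, and its powers
converge to the matrix with uniform rows by Doeblin's argument (`tendsto_pow_stable`). The first
step of the chain chooses each class with probability `1 / (2d)`. All classes have the same size
because the lattice symmetries permute `±e₁, …, ±e_d` transitively, so the limit is uniform on all
walks.
-/

namespace PivotPlus

/-! ### Convergence of powers of primitive stochastic matrices -/

section Stochastic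

open Matrix Finset

theorem stable_apply {ι : Type} (ρ : ι → ℝ) (i j : ι) : stable ρ i j = ρ j := by
  simp [stable, vecMulVec_apply]

theorem mul_stable_of_mem_rowStochastic {ι : Type} [Fintype ι] [DecidableEq ι]
    {R : Matrix ι ι ℝ} (hR : R ∈ rowStochastic ℝ ι)
    (ρ : ι → ℝ) : R * stable ρ = stable ρ := by
  rw [stable, mul_vecMulVec, hR.2]

theorem stable_mul_of_vecMul_eq {ι : Type} [Fintype ι] {R : Matrix ι ι ℝ} {ρ : ι → ℝ}
    (h : ρ ᵥ* R = ρ) :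
    stable ρ * R = stable ρ := by
  rw [stable, vecMulVec_mul, h]

/-- If the stochastic matrix `M` dominates `δ e'ρ` entrywise, then `M = δ e'ρ + (1 - δ) R` with `R`
stochastic, so that for `δ > 0` the powers `M ^ q` approach `e'ρ` like `(1 - δ) ^ q` (Doeblin). -/
theorem exists_pow_eq_stable_add {ι : Type} [Fintype ι] [DecidableEq ι]
    {M : Matrix ι ι ℝ} {ρ : ι → ℝ}
    (hM : M ∈ rowStochastic ℝ ι) (h1 : ∑ i, ρ i = 1) (hρ : ρ ᵥ* M = ρ)
    {δ : ℝ} (hδ : δ < 1) (hle : ∀ i j, δ * ρ j ≤ M i j) :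
    ∃ R ∈ rowStochastic ℝ ι,
      ∀ q : ℕ, M ^ q = stable ρ + (1 - δ) ^ q • (R ^ q - stable ρ) := by
  have hc : 0 < 1 - δ := by linarith
  set R : Matrix ι ι ℝ := (1 - δ)⁻¹ • (M - δ • stable ρ) with hRdef
  have hR : R ∈ rowStochastic ℝ ι := by
    rw [mem_rowStochastic_iff_sum]
    refine ⟨fun i j => ?_, fun i => ?_⟩
    · simp only [hRdef, Matrix.smul_apply, Matrix.sub_apply, stable_apply, smul_eq_mul]
      exact mul_nonneg (inv_nonneg.2 hc.le) (sub_nonneg.2 (hle i j))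
    · simp only [hRdef, Matrix.smul_apply, Matrix.sub_apply, stable_apply, smul_eq_mul]
      rw [← mul_sum, sum_sub_distrib, ← mul_sum, h1, sum_row_of_mem_rowStochastic hM]
      field_simp
  have hMR : M = δ • stable ρ + (1 - δ) • R := by
    rw [hRdef, smul_smul, mul_inv_cancel₀ hc.ne', one_smul]
    abel
  have hUM : stable ρ * M = stable ρ := stable_mul_of_vecMul_eq hρ
  refine ⟨R, hR, fun q => ?_⟩
  induction q with
  | zero => simp
  | succ q ih =>
    have h2 : (R ^ q - stable ρ) * M = (1 - δ) • (R ^ (q + 1) - stable ρ) := by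
      rw [sub_mul, hUM]
      conv_lhs => rw [hMR]
      rw [mul_add, mul_smul_comm, mul_smul_comm, ← pow_succ,
        mul_stable_of_mem_rowStochastic (pow_mem hR q), smul_sub, sub_smul, one_smul]
      module
    rw [pow_succ, ih, add_mul, hUM, smul_mul_assoc, h2, smul_smul, ← pow_succ]

/-- The powers of a primitive stochastic matrix converge to `e'ρ`, where `ρ` is its stationary
distribution. -/
theorem tendsto_pow_stable {ι : Type} [Fintype ι] [DecidableEq ι]
    {A : Matrix ι ι ℝ} (hA : A ∈ rowStochastic ℝ ι) (hp : A.IsPrimitive)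
    {ρ : ι → ℝ} (h0 : ∀ i, 0 ≤ ρ i) (h1 : ∑ i, ρ i = 1) (hρ : ρ ᵥ* A = ρ) :
    Tendsto (fun n : ℕ => A ^ n) atTop (𝓝 (stable ρ)) := by
  obtain ⟨k, hk, hpos⟩ := hp.exists_pos_pow
  have hρle : ∀ j, ρ j ≤ 1 := fun j => h1 ▸ single_le_sum (fun i _ => h0 i) (mem_univ j)
  have hρpow : ∀ n : ℕ, ρ ᵥ* A ^ n = ρ := by
    intro n
    induction n with
    | zero => simp
    | succ n ih => rw [pow_succ, ← vecMul_vecMul, ih, hρ]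
  obtain ⟨δ, hδ0, hδ1, hle⟩ : ∃ δ : ℝ, 0 < δ ∧ δ < 1 ∧ ∀ i j, δ * ρ j ≤ (A ^ k) i j := by
    have hex : ∃ ε : ℝ, 0 < ε ∧ ∀ i j, ε ≤ (A ^ k) i j := by
      cases isEmpty_or_nonempty ι with
      | inl h => exact ⟨1, one_pos, fun i => (h.false i).elim⟩
      | inr h =>
        obtain ⟨p, hp⟩ := Finite.exists_min (fun p : ι × ι => (A ^ k) p.1 p.2)
        exact ⟨_, hpos p.1 p.2, fun i j => hp (i, j)⟩
    obtain ⟨ε, hε, hle⟩ := hex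
    refine ⟨min ε (1 / 2), lt_min hε (by norm_num), (min_le_right _ _).trans_lt (by norm_num),
      fun i j => ?_⟩
    calc min ε (1 / 2) * ρ j ≤ ε * 1 :=
          mul_le_mul (min_le_left _ _) (hρle j) (h0 j) hε.le
      _ ≤ _ := by rw [mul_one]; exact hle i j
  obtain ⟨R, hR, hq⟩ := exists_pow_eq_stable_add (pow_mem hA k) h1 (hρpow k) hδ1 hle
  have key : ∀ n i j, |(A ^ n) i j - stable ρ i j| ≤ (1 - δ) ^ (n / k) := by
    intro n i j
    have hn : A ^ n = stable ρ + (1 - δ) ^ (n / k) • (R ^ (n / k) * A ^ (n % k) - stable ρ) := by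
      conv_lhs => rw [← Nat.div_add_mod n k, pow_add, pow_mul, hq]
      rw [add_mul, smul_mul_assoc, sub_mul, stable_mul_of_vecMul_eq (hρpow _)]
    have hS : R ^ (n / k) * A ^ (n % k) ∈ rowStochastic ℝ ι :=
      mul_mem (pow_mem hR _) (pow_mem hA _)
    rw [hn, Matrix.add_apply, add_sub_cancel_left, Matrix.smul_apply, smul_eq_mul, abs_mul,
      abs_of_nonneg (pow_nonneg (sub_nonneg.2 hδ1.le) _), Matrix.sub_apply, stable_apply]
    refine mul_le_of_le_one_right (pow_nonneg (sub_nonneg.2 hδ1.le) _) (abs_sub_le_iff.2 ⟨?_, ?_⟩)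
    · linarith [le_one_of_mem_rowStochastic hS (i := i) (j := j), h0 j]
    · linarith [nonneg_of_mem_rowStochastic hS (i := i) (j := j), hρle j]
  have hlim : Tendsto (fun n : ℕ => (1 - δ) ^ (n / k)) atTop (𝓝 0) :=
    (tendsto_pow_atTop_nhds_zero_of_lt_one (by linarith) (by linarith)).comp
      (Nat.tendsto_div_const_atTop hk.ne')
  refine tendsto_pi_nhds.2 fun i => tendsto_pi_nhds.2 fun j => ?_
  rw [tendsto_iff_dist_tendsto_zero]
  exact squeeze_zero (fun _ => dist_nonneg) (fun n => (Real.dist_eq _ _).trans_le (key n i j)) hlim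

/-- A nonnegative matrix with positive diagonal whose graph is connected is primitive: an entry of
a power stays positive in all higher powers, so that one power works for all entries. -/
theorem isPrimitive_of_reflTransGen {ι : Type} [Fintype ι] [DecidableEq ι]
    {A : Matrix ι ι ℝ} (h0 : ∀ i j, 0 ≤ A i j)
    (hdiag : ∀ i, 0 < A i i)
    (hconn : ∀ i j, Relation.ReflTransGen (fun a b => 0 < A a b) i j) : A.IsPrimitive := by
  have step : ∀ (m : ℕ) (a b c : ι), 0 < (A ^ m) a b → 0 < A b c → 0 < (A ^ (m + 1)) a c := by
    intro m a b c hab hbc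
    rw [pow_succ, mul_apply]
    exact sum_pos' (fun l _ => mul_nonneg (pow_apply_nonneg h0 m a l) (h0 l c))
      ⟨b, mem_univ b, mul_pos hab hbc⟩
  have hex : ∀ p : ι × ι, ∃ n : ℕ, ∀ m ≥ n, 0 < (A ^ m) p.1 p.2 := by
    rintro ⟨i, j⟩
    induction hconn i j with
    | refl =>
      refine ⟨0, fun m _ => ?_⟩
      induction m with
      | zero => simp
      | succ m ih => exact step m i i i (ih (Nat.zero_le _)) (hdiag i)
    | tail _ hbc ih =>
      obtain ⟨n, hn⟩ := ih
      refine ⟨n + 1, fun m hm => ?_⟩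
      obtain ⟨m, rfl⟩ : ∃ m', m = m' + 1 := ⟨m - 1, by omega⟩
      exact step m _ _ _ (hn m (by omega)) hbc
  choose n hn using hex
  exact ⟨h0, univ.sup n + 1, Nat.succ_pos _, fun i j =>
    hn (i, j) _ ((le_sup (mem_univ (i, j))).trans (Nat.le_succ _))⟩

end Stochastic

/-! ### Lattice points, unit steps and lattice symmetries -/

theorem sub_mem_lattice {d : ℕ} {x y : Space d} (hx : x ∈ lattice d) (hy : y ∈ lattice d) :
    x - y ∈ lattice d := by
  intro j
  obtain ⟨m, hm⟩ := hx j
  obtain ⟨n, hn⟩ := hy j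
  exact ⟨m - n, by simp [hm, hn]⟩

theorem add_mem_lattice {d : ℕ} {x y : Space d} (hx : x ∈ lattice d) (hy : y ∈ lattice d) :
    x + y ∈ lattice d := by
  intro j
  obtain ⟨m, hm⟩ := hx j
  obtain ⟨n, hn⟩ := hy j
  exact ⟨m + n, by simp [hm, hn]⟩

theorem intCast_smul_mem_lattice {d : ℕ} (c : ℤ) {x : Space d} (hx : x ∈ lattice d) :
    (c : ℝ) • x ∈ lattice d := by
  intro j
  obtain ⟨m, hm⟩ := hx j
  exact ⟨c * m, by simp [hm]⟩

theorem exists_int_eq_inner {d : ℕ} {x y : Space d} (hx : x ∈ lattice d) (hy : y ∈ lattice d) :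
    ∃ m : ℤ, inner ℝ x y = (m : ℝ) := by
  choose m hm using hx
  choose n hn using hy
  exact ⟨∑ j, n j * m j, by simp [PiLp.inner_apply, hm, hn]⟩

theorem mem_unitSteps_iff {d : ℕ} {v : Space d} :
    v ∈ unitSteps d ↔ ∃ j : Fin d, ∃ ε : ℝ, (ε = 1 ∨ ε = -1) ∧ v = EuclideanSpace.single j ε := by
  have hneg : ∀ j : Fin d, -EuclideanSpace.single j (1 : ℝ) = EuclideanSpace.single j (-1) := by
    intro j
    ext l
    by_cases h : l = j <;> simp [h]
  constructor
  · rintro ⟨j, rfl | rfl⟩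
    · exact ⟨j, 1, Or.inl rfl, rfl⟩
    · exact ⟨j, -1, Or.inr rfl, hneg j⟩
  · rintro ⟨j, ε, rfl | rfl, rfl⟩
    · exact ⟨j, Or.inl rfl⟩
    · exact ⟨j, Or.inr (hneg j).symm⟩

theorem mem_lattice_of_mem_unitSteps {d : ℕ} {v : Space d} (hv : v ∈ unitSteps d) :
    v ∈ lattice d := by
  obtain ⟨j, rfl | rfl⟩ := hv
  · exact single_mem_lattice j
  · simpa using intCast_smul_mem_lattice (-1) (single_mem_lattice j)

theorem norm_of_mem_unitSteps {d : ℕ} {v : Space d} (hv : v ∈ unitSteps d) : ‖v‖ = 1 := by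
  obtain ⟨j, rfl | rfl⟩ := hv <;> simp

theorem mem_unitSteps_of_norm_eq_one {d : ℕ} {v : Space d} (hv : v ∈ lattice d) (h : ‖v‖ = 1) :
    v ∈ unitSteps d := by
  choose m hm using hv
  have hsum : ∑ j, m j ^ 2 = 1 := by
    have h2 := EuclideanSpace.real_norm_sq_eq v
    simp only [h, hm, one_pow] at h2
    exact_mod_cast h2.symm
  obtain ⟨j, hj⟩ : ∃ j, m j ≠ 0 := by
    by_contra! h0
    simp [h0] at hsum
  have hj1 : 0 < m j ^ 2 := by positivity
  have hsplit := Finset.add_sum_erase Finset.univ (fun l => m l ^ 2) (Finset.mem_univ j)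
  have hnn : ∀ l ∈ Finset.univ.erase j, 0 ≤ m l ^ 2 := fun l _ => sq_nonneg _
  have hrest : ∑ l ∈ Finset.univ.erase j, m l ^ 2 = 0 := by
    have := Finset.sum_nonneg hnn
    omega
  have hzero : ∀ l, l ≠ j → m l = 0 := fun l hl =>
    pow_eq_zero_iff two_ne_zero |>.1 ((Finset.sum_eq_zero_iff_of_nonneg hnn).1 hrest l
      (Finset.mem_erase.2 ⟨hl, Finset.mem_univ l⟩))
  have hone : m j = 1 ∨ m j = -1 := by
    have h1 : m j ^ 2 = 1 := by omega
    simpa using h1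
  refine mem_unitSteps_iff.2 ⟨j, m j, by exact_mod_cast hone, ?_⟩
  ext l
  by_cases hl : l = j
  · subst hl; simp [hm]
  · simp [hl, hm, hzero l hl]

/-- The reflection in the hyperplane orthogonal to a lattice vector `a` is a lattice symmetry when
`2 / ‖a‖²` is an integer. -/
theorem exists_latticeSymm_reflection {d : ℕ} {a : Space d} (ha : a ∈ lattice d) {c : ℤ}
    (hc : (c : ℝ) * ‖a‖ ^ 2 = 2) :
    ∃ T : LatticeSymm d, ∀ x, T.1 x = x - ((c : ℝ) * inner ℝ a x) • a := by
  have ha0 : ‖a‖ ^ 2 ≠ 0 := by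
    intro h
    rw [h, mul_zero] at hc
    norm_num at hc
  have happ : ∀ x, (ℝ ∙ a)ᗮ.reflection x = x - ((c : ℝ) * inner ℝ a x) • a := by
    intro x
    have hc' : (c : ℝ) = 2 / ‖a‖ ^ 2 := (eq_div_iff ha0).2 hc
    rw [Submodule.reflection_orthogonal_apply, Submodule.reflection_singleton_apply, hc',
      neg_sub, ← Nat.cast_smul_eq_nsmul ℝ, smul_smul]
    congr 2
    simp
    ring
  have hmem : ∀ x ∈ lattice d, (ℝ ∙ a)ᗮ.reflection x ∈ lattice d := by
    intro x hx
    obtain ⟨m, hm⟩ := exists_int_eq_inner ha hx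
    rw [happ, hm]
    exact sub_mem_lattice hx (by exact_mod_cast intCast_smul_mem_lattice (c * m) ha)
  refine ⟨⟨(ℝ ∙ a)ᗮ.reflection, Set.Subset.antisymm ?_ ?_⟩, happ⟩
  · rintro _ ⟨x, hx, rfl⟩
    exact hmem x hx
  · intro x hx
    exact ⟨_, hmem x hx, Submodule.reflection_reflection _ x⟩

theorem exists_latticeSymm_reflection_single {d : ℕ} (j : Fin d) :
    ∃ T : LatticeSymm d, ∀ x, T.1 x = x - (2 * x j) • EuclideanSpace.single j (1 : ℝ) := by
  obtain ⟨T, hT⟩ := exists_latticeSymm_reflection (single_mem_lattice j) (c := 2) (by simp)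
  refine ⟨T, fun x => ?_⟩
  rw [hT, EuclideanSpace.inner_single_left]
  simp

/-- Lattice symmetries act transitively on the unit steps: orthogonal steps `u` and `v` are exchanged
by the reflection along `u - v`. -/
theorem exists_latticeSymm_map_eq {d : ℕ} {u v : Space d} (hu : u ∈ unitSteps d)
    (hv : v ∈ unitSteps d) : ∃ T : LatticeSymm d, T.1 u = v := by
  have hul := mem_lattice_of_mem_unitSteps hu
  have hvl := mem_lattice_of_mem_unitSteps hv
  have hun := norm_of_mem_unitSteps hu
  have hvn := norm_of_mem_unitSteps hv
  obtain ⟨i, ε, hε, rfl⟩ := mem_unitSteps_iff.1 hu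
  obtain ⟨j, δ, hδ, rfl⟩ := mem_unitSteps_iff.1 hv
  by_cases hij : i = j
  · subst hij
    by_cases heq : ε = δ
    · exact ⟨⟨LinearIsometryEquiv.refl ℝ _, by simp⟩, by simp [heq]⟩
    · have hneg : δ = -ε := by
        rcases hε with rfl | rfl <;> rcases hδ with rfl | rfl <;>
          first | exact absurd rfl heq | norm_num
      obtain ⟨T, hT⟩ := exists_latticeSymm_reflection_single i
      refine ⟨T, ?_⟩
      rw [hT, hneg]
      ext l
      by_cases hl : l = i
      · subst hl; simp; ring
      · simp [hl]
  · have h0 : inner ℝ (EuclideanSpace.single i ε) (EuclideanSpace.single j δ) = (0 : ℝ) := by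
      rw [EuclideanSpace.inner_single_left]; simp [hij]
    obtain ⟨T, hT⟩ := exists_latticeSymm_reflection (sub_mem_lattice hul hvl) (c := 1) (by
      rw [@norm_sub_sq_real, hun, hvn, h0]; norm_num)
    refine ⟨T, ?_⟩
    rw [hT, inner_sub_left, real_inner_self_eq_norm_sq, real_inner_comm, h0, hun]
    simp

theorem LatticeSymm.apply_mem_lattice {d : ℕ} (T : LatticeSymm d) {x : Space d}
    (hx : x ∈ lattice d) : T.1 x ∈ lattice d :=
  T.2.le (Set.mem_image_of_mem _ hx)

/-- The inverse of a lattice symmetry. -/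
noncomputable def LatticeSymm.symm {d : ℕ} (T : LatticeSymm d) : LatticeSymm d :=
  ⟨T.1.symm, by
    have h := congrArg (fun s => T.1.symm '' s) T.2
    simpa [← Set.image_comp] using h.symm⟩

/-! ### Steps of a walk and of a pivoted walk -/

/-- The `i`-th step (counted from `0`) of the sequence `w` of points. -/
def step {d N : ℕ} (w : Fin (N + 1) → Space d) (i : Fin N) : Space d := w i.succ - w i.castSucc

theorem IsSAW.step_mem_unitSteps {d N : ℕ} {w : Fin (N + 1) → Space d} (hw : IsSAW w)
    (i : Fin N) : PivotPlus.step w i ∈ unitSteps d :=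
  mem_unitSteps_of_norm_eq_one (sub_mem_lattice (hw.mem_lattice _) (hw.mem_lattice _)) (hw.step i)

theorem rotate_of_le {d N : ℕ} {k : Fin (N + 1)} {T : LatticeSymm d} {w : Fin (N + 1) → Space d}
    {i : Fin (N + 1)} (h : i ≤ k) : rotate k T w i = w i := if_pos h

theorem rotate_of_ge {d N : ℕ} {k : Fin (N + 1)} {T : LatticeSymm d} {w : Fin (N + 1) → Space d}
    {i : Fin (N + 1)} (h : k ≤ i) : rotate k T w i = w k + T.1 (w i - w k) := by
  rcases h.eq_or_lt with rfl | h
  · simp [rotate]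
  · exact if_neg (not_le.2 h)

theorem step_rotate_of_lt {d N : ℕ} {k : Fin (N + 1)} {T : LatticeSymm d}
    {w : Fin (N + 1) → Space d} {i : Fin N} (h : i.castSucc < k) :
    step (rotate k T w) i = step w i := by
  rw [step, rotate_of_le (Fin.castSucc_lt_iff_succ_le.1 h), rotate_of_le h.le, step]

theorem step_rotate_of_ge {d N : ℕ} {k : Fin (N + 1)} {T : LatticeSymm d}
    {w : Fin (N + 1) → Space d} {i : Fin N} (h : k ≤ i.castSucc) :
    step (rotate k T w) i = T.1 (step w i) := by
  rw [step, rotate_of_ge (h.trans (Fin.castSucc_lt_succ).le), rotate_of_ge h, step,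
    add_sub_add_left_eq_sub, ← map_sub, sub_sub_sub_cancel_right]

/-- A pivoted self-avoiding walk is self-avoiding as soon as its moved part misses the fixed one. -/
theorem IsSAW.rotate {d N : ℕ} {w : Fin (N + 1) → Space d} (hw : IsSAW w) {k : Fin (N + 1)}
    {T : LatticeSymm d} (h : ∀ s t, s ≤ k → k < t → w s ≠ w k + T.1 (w t - w k)) :
    IsSAW (rotate k T w) := by
  refine ⟨fun i => ?_, ?_, fun i => ?_, fun s t hst => ?_⟩
  · rcases le_total i k with hik | hik
    · rw [rotate_of_le hik]
      exact hw.mem_lattice i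
    · rw [rotate_of_ge hik]
      exact add_mem_lattice (hw.mem_lattice k)
        (T.apply_mem_lattice (sub_mem_lattice (hw.mem_lattice i) (hw.mem_lattice k)))
  · rw [rotate_of_le (Fin.zero_le k), hw.zero]
  · change ‖PivotPlus.step _ i‖ = 1
    rcases lt_or_ge i.castSucc k with hik | hik
    · rw [step_rotate_of_lt hik]
      exact hw.step i
    · rw [step_rotate_of_ge hik, LinearIsometryEquiv.norm_map]
      exact hw.step i
  · rcases le_or_gt s k with hs | hs <;> rcases le_or_gt t k with ht | ht
    · rw [rotate_of_le hs, rotate_of_le ht]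
      exact hw.injective s t hst
    · rw [rotate_of_le hs, rotate_of_ge ht.le]
      exact h s t hs ht
    · rw [rotate_of_ge hs.le, rotate_of_le ht]
      exact (h t s ht hs).symm
    · rw [rotate_of_ge hs.le, rotate_of_ge ht.le]
      intro he
      exact hw.injective s t hst (sub_left_injective (T.1.injective (add_left_cancel he)))

theorem eq_add_nsmul_of_step_eq {d N : ℕ} {w : Fin (N + 1) → Space d} {v : Space d}
    {k : Fin (N + 1)} (h : ∀ i : Fin N, k ≤ i.castSucc → step w i = v) {t : Fin (N + 1)}
    (ht : k ≤ t) : w t = w k + (t - k : ℕ) • v := by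
  induction t using Fin.induction with
  | zero =>
    obtain rfl : k = 0 := le_antisymm ht (Fin.zero_le k)
    simp
  | succ i ih =>
    rcases ht.eq_or_lt with rfl | hlt
    · simp
    · have hki : k ≤ i.castSucc := Fin.le_castSucc_iff.2 hlt
      have h1 : w i.succ = w i.castSucc + v := by rw [← h i hki, step]; abel
      have h2 : ((i.succ : ℕ) - k : ℕ) = (i.castSucc - k : ℕ) + 1 := by
        have : (k : ℕ) ≤ i := hki
        simp only [Fin.val_succ, Fin.val_castSucc]
        omega
      rw [h1, ih hki, h2, succ_nsmul, add_assoc]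

/-! ### The potential of a walk and its increase under suitable pivots -/

/-- The extent of `w` in the `l`-th coordinate direction. -/
noncomputable def width {d N : ℕ} (w : Fin (N + 1) → Space d) (l : Fin d) : ℝ :=
  ⨆ p : Fin (N + 1) × Fin (N + 1), |w p.1 l - w p.2 l|

/-- The set of straight angles of `w`, each recorded as a pair of consecutive equal steps. -/
def straightAngles {d N : ℕ} (w : Fin (N + 1) → Space d) : Set (Fin N × Fin N) :=
  {p | (p.1 : ℕ) + 1 = p.2 ∧ step w p.1 = step w p.2}

/-- The sum of the sides of the bounding box of `w`, plus the number of its straight angles. -/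
noncomputable def potential {d N : ℕ} (w : Fin (N + 1) → Space d) : ℝ :=
  ∑ l, width w l + (straightAngles w).ncard

theorem abs_sub_le_width {d N : ℕ} (w : Fin (N + 1) → Space d) (l : Fin d) (s t : Fin (N + 1)) :
    |w s l - w t l| ≤ width w l :=
  le_ciSup (f := fun p : Fin (N + 1) × Fin (N + 1) => |w p.1 l - w p.2 l|)
    (Set.finite_range _).bddAbove (s, t)

theorem width_le {d N : ℕ} {w : Fin (N + 1) → Space d} {l : Fin d} {c : ℝ}
    (h : ∀ s t, |w s l - w t l| ≤ c) : width w l ≤ c :=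
  ciSup_le fun p => h p.1 p.2

/-- A pivot at `k` can only alter the angle at `k`. -/
theorem straightAngles_subset_rotate {d N : ℕ} {w : Fin (N + 1) → Space d} {k : Fin (N + 1)}
    {T : LatticeSymm d}
    (h : ∀ p ∈ straightAngles w, p.2.castSucc = k → T.1 (step w p.2) = step w p.2) :
    straightAngles w ⊆ straightAngles (rotate k T w) := by
  rintro ⟨i, j⟩ hp
  have hij : (i : ℕ) + 1 = j := hp.1
  have hst : step w i = step w j := hp.2
  refine ⟨hij, ?_⟩
  change step (rotate k T w) i = step (rotate k T w) j
  rcases lt_or_ge j.castSucc k with hj | hj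
  · have hi : i.castSucc < k := lt_trans (Fin.lt_def.2 (by simp only [Fin.val_castSucc]; omega)) hj
    rw [step_rotate_of_lt hj, step_rotate_of_lt hi, hst]
  · rw [step_rotate_of_ge hj]
    rcases lt_or_ge i.castSucc k with hi | hi
    · have hk : j.castSucc = k := by
        have h1 : (i : ℕ) < k := hi
        have h2 : (k : ℕ) ≤ j := hj
        ext
        simp only [Fin.val_castSucc]
        omega
      rw [step_rotate_of_lt hi, h _ hp hk, hst]
    · rw [step_rotate_of_ge hi, hst]

theorem ncard_straightAngles_le_rotate {d N : ℕ} {w : Fin (N + 1) → Space d} {k : Fin (N + 1)}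
    {T : LatticeSymm d}
    (h : ∀ p ∈ straightAngles w, p.2.castSucc = k → T.1 (step w p.2) = step w p.2) :
    (straightAngles w).ncard ≤ (straightAngles (rotate k T w)).ncard :=
  Set.ncard_le_ncard (straightAngles_subset_rotate h) (Set.toFinite _)

theorem mem_pivots {N : ℕ} {k : Fin (N + 1)} : k ∈ pivots N ↔ 0 < k ∧ k < Fin.last N :=
  Finset.mem_Ioo

/-- If some coordinate, up to a sign, has its maximum strictly above its values at both endpoints,
then reflecting the part of the walk after a maximum point in the hyperplane through that point
enlarges the bounding box and keeps all straight angles. -/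
theorem exists_pivot_of_interior_max {d N : ℕ} {w : Fin (N + 1) → Space d} (hw : IsSAW w)
    {t : Fin (N + 1)} {l : Fin d} {ε : ℝ} (hε : ε = 1 ∨ ε = -1)
    (hmax : ∀ s, ε * w s l ≤ ε * w t l) (h0 : ε * w 0 l < ε * w t l)
    (hN : ε * w (Fin.last N) l < ε * w t l) :
    ∃ k ∈ pivots N, ∃ T : LatticeSymm d, IsSAW (rotate k T w) ∧
      potential w < potential (rotate k T w) := by
  have ht0 : 0 < t := Fin.pos_iff_ne_zero.2 (by rintro rfl; exact lt_irrefl _ h0)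
  have htN : t < Fin.last N := Fin.lt_last_iff_ne_last.2 (by rintro rfl; exact lt_irrefl _ hN)
  obtain ⟨T, hT⟩ := exists_latticeSymm_reflection_single l
  have hTl : ∀ x, T.1 x l = - x l := by
    intro x
    rw [hT]
    simp
    ring
  have hTne : ∀ x, ∀ l' ≠ l, T.1 x l' = x l' := by
    intro x l' hl'
    rw [hT]
    simp [hl']
  have hTfix : ∀ x : Space d, x l = 0 → T.1 x = x := by
    intro x hx
    rw [hT, hx]
    simp
  have hε2 : ∀ x : ℝ, ε * x = 0 → x = 0 := by
    intro x hx
    rcases hε with rfl | rfl <;> linarith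
  have habs : ∀ x y : ℝ, |x - y| = |ε * x - ε * y| := by
    intro x y
    rcases hε with rfl | rfl
    · simp
    · rw [← abs_neg]; congr 1; ring
  refine ⟨t, mem_pivots.2 ⟨ht0, htN⟩, T, hw.rotate fun s r hs hr heq => ?_, ?_⟩
  · -- A common point of the two parts lies in the mirror, where the reflection is the identity.
    have hl : w s l = 2 * w t l - w r l := by
      have := congrArg (fun x : Space d => x l) heq
      simp only [PiLp.add_apply, hTl, PiLp.sub_apply] at this
      linarith
    have hr0 : w r l - w t l = 0 := by
      apply hε2
      have h1 := hmax s
      have h2 := hmax r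
      rw [hl] at h1
      linarith
    rw [hTfix _ (by simpa using hr0), add_sub_cancel] at heq
    exact hw.injective s r (hs.trans_lt hr).ne heq
  · have hwne : ∀ l' ≠ l, width (rotate t T w) l' = width w l' := by
      intro l' hl'
      have : ∀ s, rotate t T w s l' = w s l' := by
        intro s
        rcases le_total s t with hs | hs
        · rw [rotate_of_le hs]
        · rw [rotate_of_ge hs, PiLp.add_apply, hTne _ _ hl', PiLp.sub_apply]
          ring
      simp only [width, this]
    have hwl : width w l < width (rotate t T w) l := by
      obtain ⟨m, hm⟩ := Finite.exists_min (fun s => ε * w s l)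
      have hwidth : width w l ≤ ε * w t l - ε * w m l := by
        refine width_le fun a b => ?_
        rw [habs, abs_sub_le_iff]
        constructor <;> linarith [hmax a, hmax b, hm a, hm b]
      refine hwidth.trans_lt ?_
      have hafter : ∀ s, t ≤ s → ε * rotate t T w s l = 2 * (ε * w t l) - ε * w s l := by
        intro s hs
        rw [rotate_of_ge hs, PiLp.add_apply, hTl, PiLp.sub_apply]
        ring
      rcases le_total m t with hmt | hmt
      · have h1 := abs_sub_le_width (rotate t T w) l (Fin.last N) m
        rw [habs, hafter _ htN.le, rotate_of_le hmt] at h1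
        have h2 := le_abs_self (2 * (ε * w t l) - ε * w (Fin.last N) l - ε * w m l)
        linarith
      · have h1 := abs_sub_le_width (rotate t T w) l m 0
        rw [habs, hafter _ hmt, rotate_of_le ht0.le] at h1
        have h2 := le_abs_self (2 * (ε * w t l) - ε * w m l - ε * w 0 l)
        linarith
    have hsum : ∑ l', width w l' < ∑ l', width (rotate t T w) l' := by
      refine Finset.sum_lt_sum (fun l' _ => ?_) ⟨l, Finset.mem_univ l, hwl⟩
      by_cases hl' : l' = l
      · subst hl'; exact hwl.le
      · exact (hwne l' hl').ge
    have hang : (straightAngles w).ncard ≤ (straightAngles (rotate t T w)).ncard := by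
      refine ncard_straightAngles_le_rotate ?_
      rintro ⟨i, j⟩ ⟨hij, hst⟩ hj
      simp only at hij hst hj
      -- At a maximum a straight angle has both sides in the mirror.
      have hi : i.succ = t := by
        rw [← hj]
        ext
        simpa using hij
      refine hTfix _ (hε2 _ ?_)
      have h1 := hmax i.castSucc
      have h2 := hmax j.succ
      have h3 := congrArg (fun x : Space d => ε * x l) hst
      simp only [step, hi, hj, PiLp.sub_apply, mul_sub] at h3 ⊢
      linarith
    have : ((straightAngles w).ncard : ℝ) ≤ (straightAngles (rotate t T w)).ncard := by
      exact_mod_cast hang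
    rw [potential, potential]
    linarith

/-- If the endpoints are opposite corners of the bounding box, then the final straight segment
lies on an edge of the box. Turning it at its initial vertex `k` in the direction of the step into
`k` moves it out of the box and gains a straight angle, while the side of the box that shrinks
loses no more than the side that grows gains. -/
theorem exists_pivot_of_opposite_corners {d N : ℕ} {w : Fin (N + 1) → Space d} (hw : IsSAW w)
    (hbox : ∀ l s, w s l ∈ Set.uIcc (w 0 l) (w (Fin.last N) l)) {i j : Fin N}
    (hij : (i : ℕ) + 1 = j) (hne : step w i ≠ step w j)
    (hlast : ∀ r, j ≤ r → step w r = step w j) :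
    ∃ k ∈ pivots N, ∃ T : LatticeSymm d, IsSAW (rotate k T w) ∧
      potential w < potential (rotate k T w) := by
  set k : Fin (N + 1) := j.castSucc with hk
  have hik : i.succ = k := Fin.ext hij
  have hk0 : 0 < k := by rw [← hik]; exact Fin.succ_pos i
  have hkN : k < Fin.last N := Fin.castSucc_lt_last j
  obtain ⟨T, hT⟩ := exists_latticeSymm_map_eq (hw.step_mem_unitSteps j) (hw.step_mem_unitSteps i)
  have hend : ∀ t, k ≤ t → w t = w k + (t - k : ℕ) • step w j := fun t ht =>
    eq_add_nsmul_of_step_eq (fun r hr => hlast r hr) ht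
  have hend' : ∀ t, k ≤ t → rotate k T w t = w k + (t - k : ℕ) • step w i := by
    intro t ht
    rw [rotate_of_ge ht, hend t ht, add_sub_cancel_left, map_nsmul, hT]
  obtain ⟨a, ε, hε, hu⟩ := mem_unitSteps_iff.1 (hw.step_mem_unitSteps i)
  obtain ⟨b, δ, hδ, hv⟩ := mem_unitSteps_iff.1 (hw.step_mem_unitSteps j)
  have hab : a ≠ b := by
    rintro rfl
    have hneg : δ = -ε := by
      rcases hε with rfl | rfl <;> rcases hδ with rfl | rfl <;>
        first | exact absurd (hu.trans hv.symm) hne | norm_num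
    refine hw.injective j.succ i.castSucc (by simp [Fin.ext_iff]; omega) ?_
    have h0 : step w j + step w i = 0 := by
      rw [hu, hv, hneg]
      ext l
      by_cases hl : l = a <;> simp [hl]
    rw [step, step, hik, ← hk, sub_add_sub_cancel] at h0
    exact sub_eq_zero.1 h0
  set n : ℕ := (Fin.last N : ℕ) - k with hn
  have hn1 : (1 : ℝ) ≤ n := by
    have : (k : ℕ) < (Fin.last N : ℕ) := hkN
    exact_mod_cast (by omega : 1 ≤ n)
  have hka : ∀ t, k ≤ t → w t a = w k a := by
    intro t ht
    rw [hend t ht, hv]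
    simp [hab]
  have hia : w i.castSucc a = w k a - ε := by
    have := congrArg (fun x : Space d => x a) hu
    simp only [step, hik, PiLp.sub_apply, PiLp.single_apply, if_true] at this
    linarith
  have hNa : w (Fin.last N) a = w k a := hka _ hkN.le
  -- The coordinate along the step into `k` attains its maximum, up to the sign `ε`, at `k`.
  have h0a : ε * w 0 a ≤ ε * w k a := by
    have := hbox a i.castSucc
    rw [hNa, hia, Set.mem_uIcc] at this
    rcases hε with rfl | rfl <;> rcases this with h | h <;> linarith [h.1, h.2]
  have hmax : ∀ s, ε * w s a ≤ ε * w k a := by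
    intro s
    have := hbox a s
    rw [hNa, Set.mem_uIcc] at this
    rcases hε with rfl | rfl <;> rcases this with h | h <;> linarith [h.1, h.2]
  refine ⟨k, mem_pivots.2 ⟨hk0, hkN⟩, T, hw.rotate fun s r hs hr heq => ?_, ?_⟩
  · rw [← rotate_of_ge hr.le, hend' r hr.le, hu] at heq
    have h1 := hmax s
    have h2 : (1 : ℝ) ≤ ((r - k : ℕ) : ℝ) := by
      have : (k : ℕ) < r := hr
      exact_mod_cast (by omega : 1 ≤ (r - k : ℕ))
    rw [heq] at h1
    simp only [PiLp.add_apply, PiLp.smul_apply, PiLp.single_apply, if_true,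
      nsmul_eq_mul] at h1
    rcases hε with rfl | rfl <;> linarith
  · have hwidth : ∀ l, width w l = |w (Fin.last N) l - w 0 l| := by
      intro l
      refine le_antisymm (width_le fun s t => ?_) (abs_sub_le_width w l _ _)
      exact Set.abs_sub_le_of_uIcc_subset_uIcc
        (Set.uIcc_subset_uIcc (hbox l t) (hbox l s))
    have hwidth' : ∀ l, width w l + ((if l = a then (n : ℝ) else 0) - if l = b then (n : ℝ) else 0)
        ≤ width (rotate k T w) l := by
      intro l
      refine le_trans ?_ (abs_sub_le_width (rotate k T w) l (Fin.last N) 0)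
      rw [hwidth, hend' _ hkN.le, hend _ hkN.le, rotate_of_le (Fin.zero_le k), hu, hv, ← hn]
      by_cases hla : l = a
      · subst hla
        have h1 : |w k l - w 0 l| = ε * (w k l - w 0 l) := by
          rcases hε with rfl | rfl
          · rw [abs_of_nonneg] <;> linarith
          · rw [abs_of_nonpos] <;> linarith
        have h2 : ε * (w k l + n * ε - w 0 l) ≤ |w k l + n * ε - w 0 l| := by
          rcases hε with rfl | rfl
          · rw [one_mul]; exact le_abs_self _
          · rw [neg_one_mul]; exact neg_le_abs _
        have h3 : ε * ε = 1 := by rcases hε with rfl | rfl <;> norm_num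
        have h4 : ε * (w k l + n * ε - w 0 l) = ε * (w k l - w 0 l) + n * (ε * ε) := by ring
        simp [hab]
        rw [h1]
        rw [h4, h3] at h2
        linarith
      · by_cases hlb : l = b
        · subst hlb
          have h1 := abs_add_le (w k l - w 0 l) (n * δ)
          have h2 : |(n : ℝ) * δ| = n := by
            rcases hδ with rfl | rfl <;> simp
          have h3 : w k l - w 0 l + n * δ = w k l + n * δ - w 0 l := by ring
          rw [h2, h3] at h1
          simp [hab.symm]
          linarith
        · simp [hla, hlb]
    have hsum : ∑ l, width w l ≤ ∑ l, width (rotate k T w) l := by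
      have := Finset.sum_le_sum (fun l (_ : l ∈ Finset.univ) => hwidth' l)
      simpa [Finset.sum_add_distrib] using this
    have hang : (straightAngles w).ncard < (straightAngles (rotate k T w)).ncard := by
      refine Set.ncard_lt_ncard (Set.ssubset_iff_of_subset
        (straightAngles_subset_rotate ?_) |>.2 ⟨(i, j), ⟨hij, ?_⟩, fun h => hne h.2⟩)
        (Set.toFinite _)
      · rintro ⟨i', j'⟩ ⟨hij', hst⟩ hj'
        obtain rfl : j' = j := Fin.castSucc_injective _ hj'
        obtain rfl : i' = i := Fin.ext (by simp only at hij'; omega)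
        exact absurd hst hne
      · change step (rotate k T w) i = step (rotate k T w) j
        rw [step_rotate_of_ge le_rfl, hT, step_rotate_of_lt]
        rw [← hik]
        exact Fin.castSucc_lt_succ
    have : ((straightAngles w).ncard : ℝ) < (straightAngles (rotate k T w)).ncard := by
      exact_mod_cast hang
    rw [potential, potential]
    linarith

theorem mem_straightWalks_of_step_eq {d N : ℕ} {α : SAW d N}
    (h : ∀ i j : Fin N, (i : ℕ) + 1 = j → step α i = step α j) (hN : 0 < N) :
    α ∈ straightWalks d N := by
  have hall : ∀ (m : ℕ) (hm : m < N), step α ⟨m, hm⟩ = step α ⟨0, hN⟩ := by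
    intro m
    induction m with
    | zero => exact fun _ => rfl
    | succ m ih => exact fun hm => (h ⟨m, by omega⟩ ⟨m + 1, hm⟩ rfl).symm.trans (ih _)
  refine ⟨_, α.2.step_mem_unitSteps ⟨0, hN⟩, fun t => ?_⟩
  have := eq_add_nsmul_of_step_eq (w := α) (k := 0) (fun i _ => hall i i.2) (Fin.zero_le t)
  simpa [α.2.zero] using this

theorem exists_pivot_potential_lt {d N : ℕ} (hN : 0 < N) {α : SAW d N}
    (hα : α ∉ straightWalks d N) :
    ∃ k ∈ pivots N, ∃ T : LatticeSymm d, IsSAW (rotate k T α) ∧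
      potential α < potential (rotate k T α) := by
  by_cases hbox : ∀ l s, α s l ∈ Set.uIcc (α 0 l) (α (Fin.last N) l)
  · have hS : {p : Fin N × Fin N | (p.1 : ℕ) + 1 = p.2 ∧ step α p.1 ≠ step α p.2}.Nonempty := by
      by_contra hS
      rw [Set.not_nonempty_iff_eq_empty] at hS
      refine hα (mem_straightWalks_of_step_eq (fun i j hij => ?_) hN)
      by_contra hne
      exact Set.notMem_empty (i, j) (hS ▸ ⟨hij, hne⟩)
    obtain ⟨⟨i, j⟩, ⟨hij, hne⟩, hlast⟩ := Set.exists_max_image _ (fun p => p.2) (Set.toFinite _) hS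
    refine exists_pivot_of_opposite_corners α.2 hbox hij hne ?_
    have hall : ∀ (m : ℕ) (hm : (j : ℕ) + m < N), step α ⟨j + m, hm⟩ = step α j := by
      intro m
      induction m with
      | zero => exact fun _ => rfl
      | succ m ih =>
        intro hm
        rw [← ih (by omega)]
        by_contra hne'
        have : (j : ℕ) + (m + 1) ≤ j :=
          hlast (⟨j + m, by omega⟩, ⟨j + (m + 1), hm⟩) ⟨by simp; omega, fun h => hne' h.symm⟩
        omega
    intro r hr
    have hr' : (j : ℕ) ≤ r := hr
    have := hall (r - j) (by omega)
    rwa [show (⟨j + (r - j), _⟩ : Fin N) = r from Fin.ext (by simp; omega)] at this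
  · push Not at hbox
    obtain ⟨l, s, hs⟩ := hbox
    obtain ⟨ε, hε, h0, hl⟩ : ∃ ε : ℝ, (ε = 1 ∨ ε = -1) ∧ ε * α 0 l < ε * α s l ∧
        ε * α (Fin.last N) l < ε * α s l := by
      rw [Set.mem_uIcc] at hs
      push Not at hs
      by_cases h : max (α 0 l) (α (Fin.last N) l) < α s l
      · rw [max_lt_iff] at h
        exact ⟨1, Or.inl rfl, by linarith [h.1], by linarith [h.2]⟩
      · refine ⟨-1, Or.inr rfl, ?_⟩
        rw [max_lt_iff, not_and_or, not_lt, not_lt] at h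
        have h1 : α s l < α 0 l ∧ α s l < α (Fin.last N) l := by
          grind
        exact ⟨by linarith [h1.1], by linarith [h1.2]⟩
    obtain ⟨t, ht⟩ := Finite.exists_max (fun s => ε * α s l)
    exact exists_pivot_of_interior_max α.2 hε ht (h0.trans_le (ht s)) (hl.trans_le (ht s))

/-! ### The pivot transition matrix -/

theorem pivotUpdate_of_isSAW {d N : ℕ} {k : Fin (N + 1)} {T : LatticeSymm d} {α : SAW d N}
    (h : IsSAW (rotate k T α)) : pivotUpdate k T α = ⟨rotate k T α, h⟩ := dif_pos h

theorem pivotUpdate_of_not_isSAW {d N : ℕ} {k : Fin (N + 1)} {T : LatticeSymm d} {α : SAW d N}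
    (h : ¬IsSAW (rotate k T α)) : pivotUpdate k T α = α := dif_neg h

theorem pivotUpdate_apply_of_le {d N : ℕ} {k : Fin (N + 1)} (T : LatticeSymm d) (α : SAW d N)
    {i : Fin (N + 1)} (hi : i ≤ k) : pivotUpdate k T α i = α i := by
  by_cases h : IsSAW (rotate k T α)
  · rw [pivotUpdate_of_isSAW h]
    exact rotate_of_le hi
  · rw [pivotUpdate_of_not_isSAW h]

theorem rotate_symm_rotate {d N : ℕ} (k : Fin (N + 1)) (T : LatticeSymm d)
    (w : Fin (N + 1) → Space d) : rotate k T.symm (rotate k T w) = w := by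
  funext i
  rcases le_total i k with hi | hi
  · rw [rotate_of_le hi, rotate_of_le hi]
  · rw [rotate_of_ge hi, rotate_of_le le_rfl, rotate_of_ge hi, add_sub_cancel_left]
    change w k + T.1.symm (T.1 (w i - w k)) = w i
    rw [T.1.symm_apply_apply, add_sub_cancel]

theorem pivotUpdate_symm_of_ne {d N : ℕ} {k : Fin (N + 1)} {T : LatticeSymm d} {α β : SAW d N}
    (hne : α ≠ β) (h : pivotUpdate k T α = β) : pivotUpdate k T.symm β = α := by
  by_cases hS : IsSAW (rotate k T α)
  · rw [pivotUpdate_of_isSAW hS] at h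
    have hβ : rotate k T.symm β = α.1 := by
      rw [← h]
      exact rotate_symm_rotate k T α
    have hS' : IsSAW (rotate k T.symm β) := by
      rw [hβ]
      exact α.2
    rw [pivotUpdate_of_isSAW hS']
    exact Subtype.ext hβ
  · exact absurd ((pivotUpdate_of_not_isSAW hS).symm.trans h) hne

theorem val_one_of_two_le {N : ℕ} (hN : 2 ≤ N) : ((1 : Fin (N + 1)) : ℕ) = 1 := by
  rw [Fin.val_one', Nat.mod_eq_of_lt (by omega)]

theorem one_le_of_mem_pivots {N : ℕ} (hN : 2 ≤ N) {k : Fin (N + 1)} (hk : k ∈ pivots N) :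
    1 ≤ k := by
  have h : 0 < (k : ℕ) := (mem_pivots.1 hk).1
  rw [Fin.le_def, val_one_of_two_le hN]
  exact h

theorem toReal_bind_apply {α β : Type} [Fintype α] (p : PMF α) (f : α → PMF β) (b : β) :
    (p.bind f b).toReal = ∑ a, (p a).toReal * (f a b).toReal := by
  rw [PMF.bind_apply, tsum_fintype, ENNReal.toReal_sum]
  · simp
  · exact fun a _ => ENNReal.mul_ne_top (PMF.apply_ne_top _ _) (PMF.apply_ne_top _ _)

theorem sum_toReal_eq_one {α : Type} [Fintype α] (p : PMF α) : ∑ a, (p a).toReal = 1 := by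
  have h := p.tsum_coe
  rw [tsum_fintype] at h
  rw [← ENNReal.toReal_sum fun a _ => p.apply_ne_top a, h, ENNReal.toReal_one]

theorem P₂_pos_iff {d N : ℕ} (hN : 2 ≤ N) {α β : SAW d N} :
    0 < P₂ d hN α β ↔ ∃ k ∈ pivots N, ∃ T : LatticeSymm d, pivotUpdate k T α = β := by
  change 0 < (pivotStep d hN α β).toReal ↔ _
  rw [ENNReal.toReal_pos_iff, and_iff_left (PMF.apply_lt_top _ _), pos_iff_ne_zero,
    ← PMF.mem_support_iff, pivotStep]
  simp [eq_comm]

theorem P₂_nonneg {d N : ℕ} (hN : 2 ≤ N) (α β : SAW d N) : 0 ≤ P₂ d hN α β :=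
  ENNReal.toReal_nonneg

theorem sum_P₂ {d N : ℕ} (hN : 2 ≤ N) (α : SAW d N) : ∑ β, P₂ d hN α β = 1 :=
  sum_toReal_eq_one (pivotStep d hN α)

/-- Inversion of the lattice symmetry matches the pivots from `α` to `β ≠ α` with those from `β`
to `α`. -/
theorem P₂_symm {d N : ℕ} (hN : 2 ≤ N) (α β : SAW d N) : P₂ d hN α β = P₂ d hN β α := by
  rcases eq_or_ne α β with rfl | hne
  · rfl
  change (pivotStep d hN α β).toReal = (pivotStep d hN β α).toReal
  rw [pivotStep, pivotStep, toReal_bind_apply, toReal_bind_apply]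
  refine Finset.sum_congr rfl fun k _ => ?_
  rw [toReal_bind_apply, toReal_bind_apply]
  congr 1
  let e : LatticeSymm d ≃ LatticeSymm d :=
    ⟨LatticeSymm.symm, LatticeSymm.symm, fun _ => rfl, fun _ => rfl⟩
  rw [← Equiv.sum_comp e fun T => (PMF.uniformOfFintype (LatticeSymm d) T).toReal *
    (PMF.pure (pivotUpdate k T β) α).toReal]
  refine Finset.sum_congr rfl fun T _ => ?_
  have hiff : β = pivotUpdate k T α ↔ α = pivotUpdate k (e T) β :=
    ⟨fun h => (pivotUpdate_symm_of_ne hne h.symm).symm,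
      fun h => (pivotUpdate_symm_of_ne hne.symm h.symm).symm⟩
  simp only [PMF.uniformOfFintype_apply, PMF.pure_apply, hiff]

/-- The identity symmetry makes every walk a possible successor of itself. -/
theorem P₂_self_pos {d N : ℕ} (hN : 2 ≤ N) (α : SAW d N) : 0 < P₂ d hN α α := by
  obtain ⟨k, hk⟩ := pivots_nonempty hN
  have hrot : rotate k (⟨LinearIsometryEquiv.refl ℝ _, by simp⟩ : LatticeSymm d) α = α.1 := by
    funext i
    simp [rotate]
  refine (P₂_pos_iff hN).2 ⟨k, hk, ⟨LinearIsometryEquiv.refl ℝ _, by simp⟩, ?_⟩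
  exact (pivotUpdate_of_isSAW (hrot.symm ▸ α.2)).trans (Subtype.ext hrot)

theorem apply_one_eq_of_P₂_ne_zero {d N : ℕ} (hN : 2 ≤ N) {α β : SAW d N}
    (h : P₂ d hN α β ≠ 0) : β 1 = α 1 := by
  obtain ⟨k, hk, T, rfl⟩ := (P₂_pos_iff hN).1 (lt_of_le_of_ne (P₂_nonneg hN α β) h.symm)
  exact pivotUpdate_apply_of_le T α (one_le_of_mem_pivots hN hk)

/-! ### Straight walks and classes of walks with a given first step -/

theorem SAW.apply_one_mem_unitSteps {d N : ℕ} (hN : 2 ≤ N) (α : SAW d N) : α 1 ∈ unitSteps d := by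
  have h := α.2.step_mem_unitSteps (⟨0, by omega⟩ : Fin N)
  have h0 : (⟨0, by omega⟩ : Fin N).castSucc = 0 := rfl
  have h1 : (⟨0, by omega⟩ : Fin N).succ = 1 := Fin.ext (val_one_of_two_le hN).symm
  rwa [step, h0, h1, α.2.zero, sub_zero] at h

theorem mem_firstStepClass_iff {d N : ℕ} {γ : unitSteps d} {α : SAW d N} :
    α ∈ firstStepClass N γ ↔ α 1 = γ.1 :=
  ⟨fun h => h.2, fun h => ⟨α.2.zero, h⟩⟩

/-- The straight walk with steps `γ`. -/
noncomputable def straightWalk {d : ℕ} (N : ℕ) (γ : unitSteps d) : SAW d N :=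
  ⟨fun i => (i : ℕ) • γ.1, by
    have hne : γ.1 ≠ 0 := by
      rw [← norm_ne_zero_iff, norm_of_mem_unitSteps γ.2]
      exact one_ne_zero
    refine ⟨fun i => ?_, by simp, fun i => ?_, fun i j hij h => hij (Fin.ext ?_)⟩
    · simpa [Nat.cast_smul_eq_nsmul] using
        intCast_smul_mem_lattice (i : ℕ) (mem_lattice_of_mem_unitSteps γ.2)
    · simp [succ_nsmul, norm_of_mem_unitSteps γ.2]
    · have h' : ((i : ℕ) : ℝ) • γ.1 = ((j : ℕ) : ℝ) • γ.1 := by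
        simpa only [Nat.cast_smul_eq_nsmul] using h
      exact_mod_cast smul_left_injective ℝ hne h'⟩

theorem straightWalk_apply_one {d N : ℕ} (hN : 2 ≤ N) (γ : unitSteps d) :
    straightWalk N γ 1 = γ.1 := by
  change ((1 : Fin (N + 1)) : ℕ) • γ.1 = γ.1
  rw [val_one_of_two_le hN, one_smul]

theorem straightWalk_mem_firstStepClass {d N : ℕ} (hN : 2 ≤ N) (γ : unitSteps d) :
    straightWalk N γ ∈ firstStepClass N γ :=
  mem_firstStepClass_iff.2 (straightWalk_apply_one hN γ)

theorem straightWalk_mem_straightWalks {d N : ℕ} (γ : unitSteps d) :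
    straightWalk N γ ∈ straightWalks d N :=
  ⟨γ.1, γ.2, fun _ => rfl⟩

theorem straightWalk_injective {d N : ℕ} (hN : 2 ≤ N) :
    Function.Injective (straightWalk (d := d) N) := by
  intro γ γ' h
  apply Subtype.ext
  rw [← straightWalk_apply_one hN γ, h, straightWalk_apply_one hN]

theorem eq_straightWalk {d N : ℕ} (hN : 2 ≤ N) {α : SAW d N} (hα : α ∈ straightWalks d N)
    {γ : unitSteps d} (h : α 1 = γ.1) : α = straightWalk N γ := by
  obtain ⟨v, -, hv⟩ := hα
  have h1 := hv 1
  rw [val_one_of_two_le hN, one_smul, h] at h1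
  refine Subtype.ext (funext fun i => ?_)
  rw [hv i, ← h1]
  rfl

instance (d : ℕ) : Finite (unitSteps d) :=
  Finite.of_injective _ (straightWalk_injective (d := d) le_rfl)

theorem ncard_unitSteps (d : ℕ) : (unitSteps d).ncard = 2 * d := by
  let f : Fin d ⊕ Fin d → Space d :=
    Sum.elim (fun j => EuclideanSpace.single j 1) (fun j => -EuclideanSpace.single j 1)
  have hf : Function.Injective f := by
    have key : ∀ i j : Fin d, EuclideanSpace.single i (1 : ℝ) ≠ -EuclideanSpace.single j 1 := by
      intro i j h
      have := congrArg (fun x : Space d => x i) h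
      by_cases hij : i = j
      · simp [hij] at this
        linarith
      · simp [hij] at this
    have key' : ∀ i j : Fin d, EuclideanSpace.single i (1 : ℝ) = EuclideanSpace.single j 1 →
        i = j := by
      intro i j h
      have := congrArg (fun x : Space d => x i) h
      by_contra hij
      simp [hij] at this
    rintro (i | i) (j | j) h
    · exact congrArg _ (key' i j h)
    · exact absurd h (key i j)
    · exact absurd h.symm (key j i)
    · exact congrArg _ (key' i j (neg_injective h))
  have hrange : unitSteps d = Set.range f := by
    ext v
    simp [unitSteps, f, exists_or, eq_comm]
  rw [hrange, ← Nat.card_coe_set_eq, Nat.card_range_of_injective hf]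
  simp
  ring

theorem ncard_straightWalks (d : ℕ) {N : ℕ} (hN : 2 ≤ N) : (straightWalks d N).ncard = 2 * d := by
  have hrange : straightWalks d N = Set.range (straightWalk N) := by
    ext α
    constructor
    · exact fun h => ⟨⟨_, α.apply_one_mem_unitSteps hN⟩, (eq_straightWalk hN h rfl).symm⟩
    · rintro ⟨γ, rfl⟩
      exact straightWalk_mem_straightWalks γ
  rw [hrange, ← Nat.card_coe_set_eq, Nat.card_range_of_injective (straightWalk_injective hN),
    Nat.card_coe_set_eq, ncard_unitSteps]

open Classical in
theorem P₁_apply {d N : ℕ} (hd : 1 ≤ d) (hN : 2 ≤ N) (α β : SAW d N) :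
    P₁ N hd α β = if β ∈ straightWalks d N then 1 / (2 * (d : ℝ)) else 0 := by
  change (straightStep N hd α β).toReal = _
  rw [straightStep, PMF.uniformOfFinset_apply, ← Set.ncard_eq_toFinset_card _ (Set.toFinite _),
    ncard_straightWalks d hN]
  by_cases h : β ∈ straightWalks d N <;> simp [h]

theorem bijective_ofClass (d : ℕ) {N : ℕ} (hN : 2 ≤ N) : Function.Bijective (ofClass d N) := by
  constructor
  · rintro ⟨γ, α, hα⟩ ⟨γ', α', hα'⟩ h
    obtain rfl : α = α' := h
    obtain rfl : γ = γ' := Subtype.ext (hα.2.symm.trans hα'.2)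
    rfl
  · exact fun α => ⟨⟨⟨_, α.apply_one_mem_unitSteps hN⟩, α, mem_firstStepClass_iff.2 rfl⟩, rfl⟩

/-- A lattice symmetry carrying `γ` to `γ'` embeds the class of `γ` into that of `γ'`. -/
theorem card_firstStepClass_le {d : ℕ} (N : ℕ) (γ γ' : unitSteps d) :
    Fintype.card (firstStepClass N γ) ≤ Fintype.card (firstStepClass N γ') := by
  obtain ⟨T, hT⟩ := exists_latticeSymm_map_eq γ.2 γ'.2
  have happ : ∀ (α : SAW d N) i, rotate 0 T α i = T.1 (α i) := by
    intro α i
    rw [rotate_of_ge (Fin.zero_le i), α.2.zero, zero_add, sub_zero]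
  have hS : ∀ α : SAW d N, IsSAW (rotate 0 T α) := by
    refine fun α => α.2.rotate fun s t hs ht h => ?_
    rw [Fin.le_zero_iff.1 hs, eq_comm, add_eq_left, EmbeddingLike.map_eq_zero_iff,
      sub_eq_zero] at h
    exact α.2.injective t 0 ht.ne' h
  refine Fintype.card_le_of_injective
    (fun α => ⟨⟨rotate 0 T α.1, hS α.1⟩, mem_firstStepClass_iff.2 ?_⟩) ?_
  · exact (happ α.1 1).trans (by rw [mem_firstStepClass_iff.1 α.2, hT])
  · intro α β h
    refine Subtype.ext (Subtype.ext (funext fun i => T.1.injective ?_))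
    rw [← happ α.1, ← happ β.1]
    exact congrFun (congrArg (fun x => x.1.1) h) i

theorem card_SAW {d N : ℕ} (hN : 2 ≤ N) (γ : unitSteps d) :
    Fintype.card (SAW d N) = 2 * d * Fintype.card (firstStepClass N γ) := by
  have := Fintype.ofFinite (unitSteps d)
  rw [← Fintype.card_of_bijective (bijective_ofClass d hN), Fintype.card_sigma,
    Finset.sum_congr rfl fun γ' _ =>
      le_antisymm (card_firstStepClass_le N γ' γ) (card_firstStepClass_le N γ γ'),
    Finset.sum_const, smul_eq_mul, Finset.card_univ, ← ncard_unitSteps d,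
    ← Nat.card_coe_set_eq, Nat.card_eq_fintype_card]

/-! ### The diagonal blocks -/

open Classical in
theorem submatrix_P₂_eq_blockDiagonal' {d N : ℕ} (hN : 2 ≤ N) :
    (P₂ d hN).submatrix (ofClass d N) (ofClass d N) = Matrix.blockDiagonal' (Q hN) := by
  ext ⟨γ, α⟩ ⟨γ', β⟩
  by_cases h : γ = γ'
  · subst h
    rw [Matrix.blockDiagonal'_apply_eq]
    rfl
  · rw [Matrix.blockDiagonal'_apply_ne _ _ _ h]
    by_contra h0
    refine h (Subtype.ext ?_)
    rw [← mem_firstStepClass_iff.1 α.2, ← mem_firstStepClass_iff.1 β.2]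
    exact (apply_one_eq_of_P₂_ne_zero hN h0).symm

open Classical in
theorem Q_mem_rowStochastic {d N : ℕ} (hN : 2 ≤ N) (γ : unitSteps d) :
    Q hN γ ∈ Matrix.rowStochastic ℝ (firstStepClass N γ) := by
  rw [Matrix.mem_rowStochastic_iff_sum]
  refine ⟨fun α β => P₂_nonneg hN _ _, fun α => ?_⟩
  change ∑ β : firstStepClass N γ, P₂ d hN α.1 β.1 = 1
  rw [← sum_P₂ hN α.1]
  refine Fintype.sum_of_injective _ Subtype.val_injective _ _ (fun β hβ => ?_) fun _ => rfl
  by_contra h0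
  refine hβ ⟨⟨β, mem_firstStepClass_iff.2 ?_⟩, rfl⟩
  rw [apply_one_eq_of_P₂_ne_zero hN h0, mem_firstStepClass_iff.1 α.2]

theorem Q_symm {d N : ℕ} (hN : 2 ≤ N) (γ : unitSteps d) (α β : firstStepClass N γ) :
    Q hN γ α β = Q hN γ β α := P₂_symm hN α.1 β.1

theorem uniform_vecMul_Q {d N : ℕ} (hN : 2 ≤ N) (γ : unitSteps d) :
    Matrix.vecMul (uniform (firstStepClass N γ)) (Q hN γ) = uniform (firstStepClass N γ) := by
  classical
  funext β
  simp only [Matrix.vecMul, dotProduct, uniform, ← Finset.mul_sum]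
  rw [Finset.sum_congr rfl fun α _ => Q_symm hN γ α β,
    Matrix.sum_row_of_mem_rowStochastic (Q_mem_rowStochastic hN γ), mul_one]

/-- A walk of maximal potential among those that can be reached from `α` is straight, by
`exists_pivot_potential_lt`. -/
theorem reflTransGen_straightWalk {d N : ℕ} (hN : 2 ≤ N) (γ : unitSteps d)
    (α : firstStepClass N γ) :
    Relation.ReflTransGen (fun a b => 0 < Q hN γ a b) α
      ⟨straightWalk N γ, straightWalk_mem_firstStepClass hN γ⟩ := by
  obtain ⟨β, hβ, hmax⟩ := Set.exists_max_image
    {β | Relation.ReflTransGen (fun a b => 0 < Q hN γ a b) α β}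
    (fun β => potential β.1.1) (Set.toFinite _) ⟨α, .refl⟩
  have hstr : β.1 ∈ straightWalks d N := by
    by_contra hns
    obtain ⟨k, hk, T, hS, hlt⟩ := exists_pivot_potential_lt (by omega) hns
    have hmem : pivotUpdate k T β.1 ∈ firstStepClass N γ := by
      rw [mem_firstStepClass_iff, pivotUpdate_apply_of_le T _ (one_le_of_mem_pivots hN hk)]
      exact mem_firstStepClass_iff.1 β.2
    have hle := hmax ⟨_, hmem⟩ (hβ.tail ((P₂_pos_iff hN).2 ⟨k, hk, T, rfl⟩))
    have heq : (pivotUpdate k T β.1).1 = rotate k T β.1 :=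
      congrArg Subtype.val (pivotUpdate_of_isSAW hS)
    exact absurd (heq ▸ hle) (not_le.2 hlt)
  have heq : β = ⟨straightWalk N γ, straightWalk_mem_firstStepClass hN γ⟩ :=
    Subtype.ext (eq_straightWalk hN hstr (mem_firstStepClass_iff.1 β.2))
  exact heq ▸ hβ

open Classical in
theorem tendsto_Q_pow {d N : ℕ} (hN : 2 ≤ N) (γ : unitSteps d) :
    Tendsto (fun n : ℕ => Q hN γ ^ n) atTop (𝓝 (stable (uniform (firstStepClass N γ)))) := by
  have : Std.Symm fun a b => 0 < Q hN γ a b := ⟨fun a b h => (Q_symm hN γ a b).subst h⟩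
  have hne : (Fintype.card (firstStepClass N γ) : ℝ) ≠ 0 := by
    have : Nonempty (firstStepClass N γ) := ⟨⟨_, straightWalk_mem_firstStepClass hN γ⟩⟩
    exact_mod_cast Fintype.card_ne_zero
  refine tendsto_pow_stable (Q_mem_rowStochastic hN γ)
    (isPrimitive_of_reflTransGen (fun α β => P₂_nonneg hN _ _) (fun α => P₂_self_pos hN _)
      fun α β => (reflTransGen_straightWalk hN γ α).trans
        (symm (reflTransGen_straightWalk hN γ β)))
    (fun _ => by simp [uniform]) ?_ (uniform_vecMul_Q hN γ)
  simp only [uniform, Finset.sum_const, Finset.card_univ, nsmul_eq_mul]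
  exact mul_one_div_cancel hne

/-! ### The limit of the whole chain -/

open Classical in
theorem submatrix_P₂_pow {d N : ℕ} (hN : 2 ≤ N) (n : ℕ) :
    (P₂ d hN ^ n).submatrix (ofClass d N) (ofClass d N) =
      Matrix.blockDiagonal' fun γ => Q hN γ ^ n := by
  induction n with
  | zero =>
    rw [pow_zero, Matrix.submatrix_one _ (bijective_ofClass d hN).1]
    simp only [pow_zero]
    exact Matrix.blockDiagonal'_one.symm
  | succ n ih =>
    have := Fintype.ofFinite (unitSteps d)
    have h := Matrix.submatrix_mul_equiv (P₂ d hN ^ n) (P₂ d hN) (ofClass d N)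
      (Equiv.ofBijective _ (bijective_ofClass d hN)) (ofClass d N)
    rw [pow_succ, ← h]
    change (P₂ d hN ^ n).submatrix (ofClass d N) (ofClass d N) *
      (P₂ d hN).submatrix (ofClass d N) (ofClass d N) = _
    rw [ih, submatrix_P₂_eq_blockDiagonal', ← Matrix.blockDiagonal'_mul]
    simp only [pow_succ]

open Classical in
theorem tendsto_P₂_pow_apply {d N : ℕ} (hN : 2 ≤ N) (τ β : SAW d N) (γ : unitSteps d)
    (hγ : β 1 = γ.1) :
    Tendsto (fun n : ℕ => (P₂ d hN ^ n) τ β) atTop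
      (𝓝 (if τ 1 = γ.1 then 1 / (Fintype.card (firstStepClass N γ) : ℝ) else 0)) := by
  have h : ∀ n, (P₂ d hN ^ n) τ β = Matrix.blockDiagonal' (fun γ => Q hN γ ^ n)
      ⟨⟨_, τ.apply_one_mem_unitSteps hN⟩, τ, mem_firstStepClass_iff.2 rfl⟩
      ⟨γ, β, mem_firstStepClass_iff.2 hγ⟩ := fun n => by rw [← submatrix_P₂_pow]; rfl
  simp only [h]
  by_cases hτ : τ 1 = γ.1
  · obtain rfl : γ = ⟨_, τ.apply_one_mem_unitSteps hN⟩ := Subtype.ext hτ.symm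
    simp only [Matrix.blockDiagonal'_apply_eq, if_true]
    have := tendsto_pi_nhds.1 (tendsto_pi_nhds.1 (tendsto_Q_pow hN _)
      ⟨τ, mem_firstStepClass_iff.2 rfl⟩) ⟨β, mem_firstStepClass_iff.2 hγ⟩
    rwa [stable_apply] at this
  · have hne : (⟨_, τ.apply_one_mem_unitSteps hN⟩ : unitSteps d) ≠ γ :=
      fun h => hτ (congrArg Subtype.val h)
    simp only [Matrix.blockDiagonal'_apply_ne _ _ _ hne, if_neg hτ]
    exact tendsto_const_nhds

/-- Each class contains exactly one straight walk, and all classes have the same size. -/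
theorem tendsto_P₁_mul_P₂_pow {d N : ℕ} (hd : 1 ≤ d) (hN : 2 ≤ N) :
    Tendsto (fun n : ℕ => P₁ N hd * P₂ d hN ^ n) atTop (𝓝 (stable (uniform (SAW d N)))) := by
  classical
  refine tendsto_pi_nhds.2 fun α => tendsto_pi_nhds.2 fun β => ?_
  let γ : unitSteps d := ⟨_, β.apply_one_mem_unitSteps hN⟩
  have hlim := tendsto_finsetSum Finset.univ fun τ (_ : τ ∈ Finset.univ) =>
    (tendsto_P₂_pow_apply hN τ β γ rfl).const_mul (P₁ N hd α τ)
  refine hlim.trans_eq (congrArg 𝓝 ?_)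
  rw [stable_apply, Finset.sum_eq_single (straightWalk N γ)]
  · rw [P₁_apply hd hN, if_pos (straightWalk_mem_straightWalks γ),
      if_pos (straightWalk_apply_one hN γ), uniform, card_SAW hN γ]
    push_cast
    rw [one_div_mul_one_div]
  · intro τ _ hτ
    rw [P₁_apply hd hN]
    by_cases h1 : τ ∈ straightWalks d N
    · rw [if_neg fun h => hτ (eq_straightWalk hN h1 h), mul_zero]
    · rw [if_neg h1, zero_mul]
  · exact fun h => absurd (Finset.mem_univ _) h

open Classical in
theorem distribution_zero {d N : ℕ} (hd : 1 ≤ d) (hN : 2 ≤ N) (ω α : SAW d N) :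
    distribution hd hN ω 0 α = if α = ω then 1 else 0 := by
  by_cases h : α = ω <;> simp [distribution, law, h]

theorem distribution_one {d N : ℕ} (hd : 1 ≤ d) (hN : 2 ≤ N) (ω : SAW d N) :
    distribution hd hN ω 1 = Matrix.vecMul (distribution hd hN ω 0) (P₁ N hd) :=
  funext fun α => toReal_bind_apply (PMF.pure ω) (straightStep N hd) α

theorem distribution_succ {d N : ℕ} (hd : 1 ≤ d) (hN : 2 ≤ N) (ω : SAW d N) {n : ℕ} (hn : 1 ≤ n) :
    distribution hd hN ω (n + 1) = Matrix.vecMul (distribution hd hN ω n) (P₂ d hN) := by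
  obtain ⟨n, rfl⟩ : ∃ m, n = m + 1 := ⟨n - 1, by omega⟩
  exact funext fun α => toReal_bind_apply (law hd hN ω (n + 1)) (pivotStep d hN) α

theorem distribution_eq_row {d N : ℕ} (hd : 1 ≤ d) (hN : 2 ≤ N) (ω : SAW d N) (n : ℕ) :
    distribution hd hN ω (n + 1) = (P₁ N hd * P₂ d hN ^ n) ω := by
  classical
  induction n with
  | zero =>
    rw [distribution_one]
    funext α
    simp [Matrix.vecMul, dotProduct, distribution_zero]
  | succ n ih =>
    rw [distribution_succ hd hN ω (Nat.le_add_left 1 n), ih, pow_succ, ← Matrix.mul_assoc]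
    rfl

end PivotPlus

open PivotPlus
open Classical in
theorem theorem2p8 (d N : ℕ) (hd : 1 ≤ d) (hN : 2 ≤ N) (ω : SAW d N) :
    (∀ α, distribution hd hN ω 0 α = if α = ω then 1 else 0) ∧
    (distribution hd hN ω 1 = Matrix.vecMul (distribution hd hN ω 0) (P₁ N hd) ∧
      (∀ n, 1 ≤ n → distribution hd hN ω (n + 1) =
        Matrix.vecMul (distribution hd hN ω n) (P₂ d hN)) ∧
      (∀ α β, P₁ N hd α β = if β ∈ straightWalks d N then 1 / (2 * (d : ℝ)) else 0) ∧
      Function.Bijective (ofClass d N) ∧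
      (P₂ d hN).submatrix (ofClass d N) (ofClass d N) = Matrix.blockDiagonal' (Q hN) ∧
      (∀ γ : unitSteps d, Q hN γ ∈ Matrix.rowStochastic ℝ (firstStepClass N γ))) ∧
    (∀ γ : unitSteps d, Matrix.vecMul (uniform (firstStepClass N γ)) (Q hN γ) =
      uniform (firstStepClass N γ)) ∧
    (∀ γ : unitSteps d, Tendsto (fun n : ℕ => Q hN γ ^ n) atTop
      (𝓝 (stable (uniform (firstStepClass N γ))))) ∧
    Tendsto (fun n : ℕ => P₁ N hd * P₂ d hN ^ n) atTop (𝓝 (stable (uniform (SAW d N)))) ∧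
    Tendsto (distribution hd hN ω) atTop (𝓝 (uniform (SAW d N))) := by
  refine ⟨distribution_zero hd hN ω,
    ⟨distribution_one hd hN ω, fun n hn => distribution_succ hd hN ω hn, P₁_apply hd hN,
      bijective_ofClass d hN, submatrix_P₂_eq_blockDiagonal' hN, Q_mem_rowStochastic hN⟩,
    uniform_vecMul_Q hN, tendsto_Q_pow hN, tendsto_P₁_mul_P₂_pow hd hN, ?_⟩
  rw [← tendsto_add_atTop_iff_nat 1]
  simp only [distribution_eq_row]
  have hlim := tendsto_pi_nhds.1 (tendsto_P₁_mul_P₂_pow hd hN) ω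
  rwa [show stable (uniform (SAW d N)) ω = uniform (SAW d N) from
    funext fun β => stable_apply _ _ _] at hlim
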